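/- **Setting.** Let $\Omega\subset\mathbb R^d$ be a bounded connected open set with $C^1$ boundary $\Gamma=\partial\Omega$. Let $\Gamma_D,\Gamma_N\subset\Gamma$ be nonempty, disjoint and relatively open in $\Gamma$, with $\Gamma=\overline{\Gamma_D\cup\Gamma_N}$ and $\mathcal H^{d-1}(\partial\Gamma_D\cap\partial\Gamma_N)=0$ (relative boundaries in $\Gamma$); write $ds=d\mathcal H^{d-1}$ for the surface measure. Let $\alpha>1$, $\beta>0$, $\gamma=\frac{\beta+1}{\beta}\alpha$, $\gamma'=\frac{\gamma}{\gamma-1}$, and let $j\in L^{\gamma'}(\Gamma_N)$ with $j\ge 0$ and $j\not\equiv0$. Let $g:[0,\infty)\to\mathbb R$ be continuous and strictly increasing, and let $H:\Omega\times\mathbb R^d\to\mathbb R$ be such that $H(\cdot,p)$ is measurable for every $p$ and, for a.e. $x\in\Omega$, $H(x,\cdot)$ is $C^1$ and convex. Suppose that there is a constant $C>1$ with the following properties: 1. $C^{-1}m^\beta-C\le g(m)\le Cm^\beta+C$ for all $m\ge0$; 2. $|D_pH(x,p)|\le C|p|^{\alpha-1}+C$ and $H(x,0)\le C$ for a.e.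 $x\in\Omega$ and all $p\in\mathbb R^d$; 3. for a.e. $x\in\Omega$ and all $p\in\mathbb R^d$, one of the following holds: (a) $H(x,p)\ge C^{-1}|p|^\alpha-C$; (b) $D_pH(x,p)\cdot p\ge C^{-1}|p|^\alpha-C$ and $H(x,p)\ge -C$; (c) $-H(x,p)+D_pH(x,p)\cdot p\ge C^{-1}|p|^\alpha-C$ and $H(x,p)\ge-C$. The *extended inverse* $g^{-1}:\mathbb R\to[0,\infty)$ is defined by $g(g^{-1}(z))=z$ for $z\ge g(0)$ and $g^{-1}(z)=0$ for $z<g(0)$. Write $q_+=\max\{q,0\}$. Functions in $W^{1,\gamma}(\Omega)$ are understood in the sense of traces on $\Gamma$. For $\epsilon>0$, $m\in L^{\beta+1}(\Omega)$ and $h\in L^{\gamma'}(\Gamma_D)$ with $m,h\ge0$, $u,v\in W^{1,\gamma}(\Omega)$, $\mu\in L^{\beta+1}(\Omega)$ and $k\in L^{\gamma'}(\Gamma_D)$, let $$\langle A_\epsilon(m,u,h),(\mu,v,k)\rangle=\int_\Omega[-H(x,Du)+g(m)]\,\mu\,dx+\int_\Omega mD_pH(x,Du)\cdot Dv\,dx-\int_{\Gamma_N}jv\,ds+\int_{\Gamma_D}hv\,ds+\int_{\Gamma_D}(-u+\epsilon^{\gamma'}h^{\gamma'-1})\,k\,ds,$$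 and, for fixed $u$, let $\langle A_u(m,h),(\mu,k)\rangle:=\langle A_\epsilon(m,u,h),(\mu,0,k)\rangle$. Let $\mathcal K=\{(m,h)\in L^{\beta+1}(\Omega)\times L^{\gamma'}(\Gamma_D): m\ge0,\ h\ge0\}$. **Theorem.** Let $\epsilon>0$ and $u\in W^{1,\gamma}(\Omega)$. Then: * $A_u$ is well defined from $\mathcal K$ to $L^{(\beta+1)/\beta}(\Omega)\times L^{\gamma}(\Gamma_D)$; that is, for every $(m,h)\in\mathcal K$ we have $-H(\cdot,Du)+g(m)\in L^{(\beta+1)/\beta}(\Omega)$ and $-u+\epsilon^{\gamma'}h^{\gamma'-1}\in L^\gamma(\Gamma_D)$. * There is a unique pair $(m_u,h_u)\in\mathcal K$ such that $$\langle A_u(m_u,h_u),(\mu-m_u,k-h_u)\rangle\ge0\qquad\text{for all }(\mu,k)\in\mathcal K.$$ * For a.e. $x\in\Omega$: $-H(x,Du(x))+g(m_u(x))\ge0$, $\;m_u(x)\bigl(-H(x,Du(x))+g(m_u(x))\bigr)=0$, and $m_u(x)=g^{-1}(H(x,Du(x)))$. * For $\mathcal H^{d-1}$-a.e. $x\in\Gamma_D$: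 $-u(x)+\epsilon^{\gamma'}h_u(x)^{\gamma'-1}\ge0$, $\;h_u(x)\bigl(-u(x)+\epsilon^{\gamma'}h_u(x)^{\gamma'-1}\bigr)=0$, and $h_u(x)=\epsilon^{-\gamma}\,u_+(x)^{\gamma-1}$. In particular, $h_u=u_+^{\gamma-1}$ on $\Gamma_D$ when $\epsilon=1$. -/

import Mathlib

open MeasureTheory Set Filter Topology
open scoped ENNReal ContDiff

namespace MFG

noncomputable section

/-- The Euclidean space `ℝ^d`. -/
abbrev E (d : ℕ) := EuclideanSpace ℝ (Fin d)

/-! ### Exponents -/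

/-- The two key exponents `α > 1` and `β > 0`. -/
structure Exponents where
  α : ℝ
  β : ℝ
  one_lt_α : 1 < α
  β_pos : 0 < β

namespace Exponents

/-- The auxiliary exponent `γ = (β + 1) / β * α`. -/
def γ (e : Exponents) : ℝ := (e.β + 1) / e.β * e.α

/-- The Hölder conjugate `γ' = γ / (γ - 1)`. -/
def γ' (e : Exponents) : ℝ := e.γ / (e.γ - 1)

theorem one_lt_γ (e : Exponents) : 1 < e.γ := by
  have h1 := e.one_lt_α
  have h2 := e.β_pos
  unfold γ
  rw [div_mul_eq_mul_div, lt_div_iff₀ h2]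
  nlinarith

instance (e : Exponents) : Fact (1 ≤ ENNReal.ofReal e.γ) :=
  ⟨by rw [ENNReal.one_le_ofReal]; exact e.one_lt_γ.le⟩

end Exponents

/-! ### The domain -/

/-- The open set `Ω` has a `C¹` boundary: near each boundary point, `Ω` is the sublevel set
`{ψ < 0}` of a `C¹` function `ψ` with non-vanishing differential at that point. -/
def HasC1Boundary {d : ℕ} (Ω : Set (E d)) : Prop :=
  ∀ x ∈ frontier Ω, ∃ U : Set (E d), IsOpen U ∧ x ∈ U ∧ ∃ ψ : E d → ℝ,
    ContDiffOn ℝ 1 ψ U ∧ fderiv ℝ ψ x ≠ 0 ∧ Ω ∩ U = {y ∈ U | ψ y < 0}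

/-- The surface measure: the `(d-1)`-dimensional Hausdorff measure, with the normalization that
gives the usual surface area. -/
def surfaceMeasure (d : ℕ) : Measure (E d) := μHE[d - 1]

/-- `Ω` is a bounded `C¹` domain whose boundary is partitioned into a Dirichlet part `ΓD` and a
Neumann part `ΓN`. -/
structure IsMixedDomain {d : ℕ} (Ω ΓD ΓN : Set (E d)) : Prop where
  isOpen : IsOpen Ω
  isConnected : IsConnected Ω
  isBounded : Bornology.IsBounded Ω
  c1_boundary : HasC1Boundary Ω
  relOpen_D : ∃ U : Set (E d), IsOpen U ∧ ΓD = U ∩ frontier Ω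
  relOpen_N : ∃ U : Set (E d), IsOpen U ∧ ΓN = U ∩ frontier Ω
  nonempty_D : ΓD.Nonempty
  nonempty_N : ΓN.Nonempty
  disjoint : ΓD ∩ ΓN = ∅
  cover : frontier Ω = closure (ΓD ∪ ΓN)
  -- `ΓD` and `ΓN` are relatively open in `∂Ω`, so these are their relative boundaries in `∂Ω`
  interface_null : surfaceMeasure d ((closure ΓD \ ΓD) ∩ (closure ΓN \ ΓN)) = 0

/-! ### Sobolev functions and traces -/

/-- `G` is the weak gradient of `u` in `Ω`, tested against `C_c^∞(Ω)`. -/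
def HasWeakGradient {d : ℕ} (Ω : Set (E d)) (u : E d → ℝ) (G : E d → E d) : Prop :=
  ∀ φ : E d → ℝ, ContDiff ℝ ∞ φ → HasCompactSupport φ → tsupport φ ⊆ Ω → ∀ v : E d,
    ∫ x in Ω, u x * fderiv ℝ φ x v = - ∫ x in Ω, inner ℝ (G x) v * φ x

theorem integrable_mul_test {d : ℕ} {Ω : Set (E d)} {p : ℝ≥0∞} (hp : 1 ≤ p) {f ψ : E d → ℝ}
    (hf : MemLp f p (volume.restrict Ω)) (hψ : Continuous ψ) (hc : HasCompactSupport ψ) :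
    Integrable (fun x => f x * ψ x) (volume.restrict Ω) := by
  have h := (hf.locallyIntegrable hp).integrable_smul_right_of_hasCompactSupport hψ hc
  simpa [smul_eq_mul] using h

theorem continuous_fderiv_test {d : ℕ} {φ : E d → ℝ} (hφ : ContDiff ℝ ∞ φ) (v : E d) :
    Continuous (fun x => fderiv ℝ φ x v) :=
  (hφ.continuous_fderiv (by simp)).clm_apply continuous_const

/-- The Sobolev space `W^{1,p}(Ω)`, as the space of pairs `(u, Du)` in `L^p × L^p` with `Du` the
weak gradient of `u`, with the norm `max (‖u‖_p) (‖Du‖_p)`. -/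
def W1p {d : ℕ} (Ω : Set (E d)) (p : ℝ≥0∞) [Fact (1 ≤ p)] :
    Submodule ℝ (Lp ℝ p (volume.restrict Ω) × Lp (E d) p (volume.restrict Ω)) where
  carrier := {w | HasWeakGradient Ω w.1 w.2}
  zero_mem' := by
    intro φ _ _ _ v
    have h1 : ∫ x in Ω, (0 : Lp ℝ p (volume.restrict Ω)) x * fderiv ℝ φ x v = 0 := by
      apply integral_eq_zero_of_ae
      filter_upwards [Lp.coeFn_zero ℝ p (volume.restrict Ω)] with x hx
      rw [hx]
      simp
    have h2 : ∫ x in Ω, inner ℝ ((0 : Lp (E d) p (volume.restrict Ω)) x) v * φ x = 0 := by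
      apply integral_eq_zero_of_ae
      filter_upwards [Lp.coeFn_zero (E d) p (volume.restrict Ω)] with x hx
      rw [hx]
      simp
    simp only [Prod.fst_zero, Prod.snd_zero]
    rw [h1, h2, neg_zero]
  add_mem' := by
    rintro ⟨u, G⟩ ⟨u', G'⟩ h h' φ hφ hc hs v
    have hp : 1 ≤ p := Fact.out
    have a := h φ hφ hc hs v
    have a' := h' φ hφ hc hs v
    have hcd : HasCompactSupport (fun x => fderiv ℝ φ x v) := hc.fderiv_apply (𝕜 := ℝ) v
    have e1 : ∫ x in Ω, (u + u') x * fderiv ℝ φ x v =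
        (∫ x in Ω, u x * fderiv ℝ φ x v) + ∫ x in Ω, u' x * fderiv ℝ φ x v := by
      rw [← integral_add (integrable_mul_test hp (Lp.memLp u) (continuous_fderiv_test hφ v) hcd)
        (integrable_mul_test hp (Lp.memLp u') (continuous_fderiv_test hφ v) hcd)]
      apply integral_congr_ae
      filter_upwards [Lp.coeFn_add u u'] with x hx
      rw [hx, Pi.add_apply, add_mul]
    have e2 : ∫ x in Ω, inner ℝ ((G + G') x) v * φ x =
        (∫ x in Ω, inner ℝ (G x) v * φ x) + ∫ x in Ω, inner ℝ (G' x) v * φ x := by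
      rw [← integral_add
        (integrable_mul_test hp ((Lp.memLp G).inner_const v) hφ.continuous hc)
        (integrable_mul_test hp ((Lp.memLp G').inner_const v) hφ.continuous hc)]
      apply integral_congr_ae
      filter_upwards [Lp.coeFn_add G G'] with x hx
      rw [hx, Pi.add_apply, inner_add_left, add_mul]
    simp only [Prod.mk_add_mk] at *
    rw [e1, e2, a, a']
    ring
  smul_mem' := by
    rintro c ⟨u, G⟩ h φ hφ hc hs v
    have a := h φ hφ hc hs v
    have e1 : ∫ x in Ω, (c • u) x * fderiv ℝ φ x v = c * ∫ x in Ω, u x * fderiv ℝ φ x v := by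
      rw [← integral_const_mul]
      apply integral_congr_ae
      filter_upwards [Lp.coeFn_smul c u] with x hx
      rw [hx, Pi.smul_apply, smul_eq_mul, mul_assoc]
    have e2 : ∫ x in Ω, inner ℝ ((c • G) x) v * φ x = c * ∫ x in Ω, inner ℝ (G x) v * φ x := by
      rw [← integral_const_mul]
      apply integral_congr_ae
      filter_upwards [Lp.coeFn_smul c G] with x hx
      rw [hx, Pi.smul_apply, real_inner_smul_left, mul_assoc]
    simp only [Prod.smul_mk] at *
    rw [e1, e2, a]
    ring

/-- The weak gradient `Du` of `u ∈ W^{1,p}(Ω)`. -/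
def W1p.grad {d : ℕ} {Ω : Set (E d)} {p : ℝ≥0∞} [Fact (1 ≤ p)] (u : W1p Ω p) :
    Lp (E d) p (volume.restrict Ω) := u.1.2

/-- `T` is the trace operator `W^{1,p}(Ω) → L^p(∂Ω)`: the continuous linear operator with
`T u = u|_∂Ω` for all `u ∈ W^{1,p}(Ω) ∩ C(closure Ω)`. -/
def IsTraceOperator {d : ℕ} (Ω : Set (E d)) (p : ℝ≥0∞) [Fact (1 ≤ p)]
    (T : W1p Ω p →L[ℝ] Lp ℝ p ((surfaceMeasure d).restrict (frontier Ω))) : Prop :=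
  ∀ (u : W1p Ω p) (φ : E d → ℝ), ContinuousOn φ (closure Ω) →
    (u.1.1 =ᵐ[volume.restrict Ω] φ) → T u =ᵐ[(surfaceMeasure d).restrict (frontier Ω)] φ

open Classical in
/-- The trace operator. For a bounded `C¹` domain and finite `p` it exists and is unique, by the
trace theorem and the density of `W^{1,p}(Ω) ∩ C(closure Ω)`, so the second branch (which only
makes the definition total) is not taken. -/
def trace {d : ℕ} (Ω : Set (E d)) (p : ℝ≥0∞) [Fact (1 ≤ p)] :
    W1p Ω p →L[ℝ] Lp ℝ p ((surfaceMeasure d).restrict (frontier Ω)) :=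
  if h : ∃ T, IsTraceOperator Ω p T then h.choose else 0

/-! ### The Hamiltonian and the coupling -/

/-- `D_p H(x,p)`. -/
def DpH {d : ℕ} (H : E d → E d → ℝ) (x p : E d) : E d := gradient (H x) p

/-- The structural assumptions on the Hamiltonian `H` on `Ω × ℝ^d` and on the coupling `g` on
`[0, ∞)`. (The values of `H` for `x ∉ Ω` and of `g` on `(-∞, 0)` are irrelevant.) -/
structure StructuralAssumptions {d : ℕ} (e : Exponents) (Ω : Set (E d)) (H : E d → E d → ℝ)
    (g : ℝ → ℝ) : Prop where
  continuous_g : ContinuousOn g (Ici 0)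
  measurable_H : ∀ p, AEMeasurable (fun x => H x p) (volume.restrict Ω)
  c1_H : ∀ᵐ x ∂(volume.restrict Ω), ContDiff ℝ 1 (H x)
  strictMono_g : StrictMonoOn g (Ici 0)
  convex_H : ∀ᵐ x ∂(volume.restrict Ω), ConvexOn ℝ univ (H x)
  growth_g : ∃ C : ℝ, 1 < C ∧ ∀ m : ℝ, 0 ≤ m →
    C⁻¹ * m ^ e.β - C ≤ g m ∧ g m ≤ C * m ^ e.β + C
  growth_H : ∃ C : ℝ, 1 < C ∧ ∀ᵐ x ∂(volume.restrict Ω),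
    (∀ p, ‖DpH H x p‖ ≤ C * ‖p‖ ^ (e.α - 1) + C) ∧ H x 0 ≤ C
  coercive_H : ∃ C : ℝ, 1 < C ∧ ∀ᵐ x ∂(volume.restrict Ω), ∀ p,
    (C⁻¹ * ‖p‖ ^ e.α - C ≤ H x p) ∨
    (C⁻¹ * ‖p‖ ^ e.α - C ≤ inner ℝ (DpH H x p) p ∧ -C ≤ H x p) ∨
    (C⁻¹ * ‖p‖ ^ e.α - C ≤ -H x p + inner ℝ (DpH H x p) p ∧ -C ≤ H x p)

/-- `G : ℝ → [0, ∞)` is an extended inverse of `g : [0, ∞) → ℝ`. -/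
def IsExtendedInverse (g G : ℝ → ℝ) : Prop :=
  (∀ z, 0 ≤ G z) ∧ (∀ z, g 0 ≤ z → g (G z) = z) ∧ (∀ z, z < g 0 → G z = 0)

/-- The extended inverse `g⁻¹`: for `z ≥ g(0)` a preimage of `z` in `[0, ∞)`, and `0` for
`z < g(0)`. -/
def extendedInverse (g : ℝ → ℝ) (z : ℝ) : ℝ :=
  open Classical in if g 0 ≤ z then Function.invFunOn g (Ici 0) z else 0

/-- Under the structural assumptions, `extendedInverse g` is an extended inverse of `g`, and the
only one. -/
theorem StructuralAssumptions.isExtendedInverse_iff {d : ℕ} {e : Exponents} {Ω : Set (E d)}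
    {H : E d → E d → ℝ} {g : ℝ → ℝ} (hS : StructuralAssumptions e Ω H g) (G : ℝ → ℝ) :
    IsExtendedInverse g G ↔ G = extendedInverse g := by
  have hsurj : ∀ z, g 0 ≤ z → ∃ m ∈ Ici (0 : ℝ), g m = z := by
    intro z hz
    obtain ⟨C, hC, hg⟩ := hS.growth_g
    have hC0 : (0 : ℝ) < C := by linarith
    have ht : Tendsto (fun m : ℝ => C⁻¹ * m ^ e.β - C) atTop atTop :=
      tendsto_atTop_add_const_right _ _
        ((tendsto_rpow_atTop e.β_pos).const_mul_atTop (inv_pos.mpr hC0))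
    obtain ⟨M, hM0, hM⟩ := ((eventually_ge_atTop (0 : ℝ)).and (ht.eventually_ge_atTop z)).exists
    have hzM : z ≤ g M := hM.trans (hg M hM0).1
    obtain ⟨m, hm, hmz⟩ := intermediate_value_Icc hM0
      (hS.continuous_g.mono Icc_subset_Ici_self) ⟨hz, hzM⟩
    exact ⟨m, hm.1, hmz⟩
  have hE : IsExtendedInverse g (extendedInverse g) := by
    refine ⟨fun z => ?_, fun z hz => ?_, fun z hz => ?_⟩
    · unfold extendedInverse
      split_ifs with h
      · exact Function.invFunOn_mem (hsurj z h)
      · exact le_rfl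
    · unfold extendedInverse
      rw [if_pos hz]
      exact Function.invFunOn_eq (hsurj z hz)
    · unfold extendedInverse
      rw [if_neg (not_le.mpr hz)]
  refine ⟨fun hG => ?_, fun h => h ▸ hE⟩
  funext z
  rcases le_or_gt (g 0) z with hz | hz
  · exact hS.strictMono_g.injOn (hG.1 z) (hE.1 z) ((hG.2.1 z hz).trans (hE.2.1 z hz).symm)
  · rw [hG.2.2 z hz, hE.2.2 z hz]

/-! ### The operator -/

/-- `L^{β+1}(Ω)`, the space of densities. -/
abbrev DensitySpace {d : ℕ} (e : Exponents) (Ω : Set (E d)) :=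
  Lp ℝ (ENNReal.ofReal (e.β + 1)) (volume.restrict Ω)

/-- `L^{γ'}(S)` for a part `S` of the boundary, the space of boundary fluxes. -/
abbrev FluxSpace {d : ℕ} (e : Exponents) (S : Set (E d)) :=
  Lp ℝ (ENNReal.ofReal e.γ') ((surfaceMeasure d).restrict S)

/-- `W^{1,γ}(Ω)`. -/
abbrev ValueSpace {d : ℕ} (e : Exponents) (Ω : Set (E d)) := W1p Ω (ENNReal.ofReal e.γ)

/-- The first component `-H(x,Du) + g(m)` of the operator. -/
def hjResidual {d : ℕ} {e : Exponents} {Ω : Set (E d)} (H : E d → E d → ℝ) (g : ℝ → ℝ)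
    (m : DensitySpace e Ω) (u : ValueSpace e Ω) (x : E d) : ℝ :=
  -H x (W1p.grad u x) + g (m x)

/-- The third component `-u + ε^{γ'} h^{γ'-1}` of the operator. -/
def boundaryResidual {d : ℕ} {e : Exponents} {Ω ΓD : Set (E d)} (ε : ℝ)
    (u : ValueSpace e Ω) (h : FluxSpace e ΓD) (x : E d) : ℝ :=
  -trace Ω (ENNReal.ofReal e.γ) u x + ε ^ e.γ' * h x ^ (e.γ' - 1)

/-- The pairing `⟨A_ε (m, u, h), (μ, v, k)⟩`. -/
def pairing {d : ℕ} {e : Exponents} {Ω ΓD ΓN : Set (E d)} (ε : ℝ) (H : E d → E d → ℝ)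
    (g : ℝ → ℝ) (j : FluxSpace e ΓN)
    (m : DensitySpace e Ω) (u : ValueSpace e Ω) (h : FluxSpace e ΓD)
    (μ : DensitySpace e Ω) (v : ValueSpace e Ω) (k : FluxSpace e ΓD) : ℝ :=
  (∫ x in Ω, hjResidual H g m u x * μ x)
  + (∫ x in Ω, m x * inner ℝ (DpH H x (W1p.grad u x)) (W1p.grad v x))
  - (∫ x in ΓN, j x * trace Ω (ENNReal.ofReal e.γ) v x ∂(surfaceMeasure d))
  + (∫ x in ΓD, h x * trace Ω (ENNReal.ofReal e.γ) v x ∂(surfaceMeasure d))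
  + (∫ x in ΓD, boundaryResidual ε u h x * k x ∂(surfaceMeasure d))

/-- The pairing `⟨A_u (m, h), (μ, k)⟩ = ⟨A_ε (m, u, h), (μ, 0, k)⟩` of the restricted operator. -/
def restrictedPairing {d : ℕ} {e : Exponents} {Ω ΓD ΓN : Set (E d)} (ε : ℝ)
    (H : E d → E d → ℝ) (g : ℝ → ℝ) (j : FluxSpace e ΓN) (u : ValueSpace e Ω)
    (mh μk : DensitySpace e Ω × FluxSpace e ΓD) : ℝ :=
  pairing ε H g j mh.1 u mh.2 μk.1 0 μk.2

/-- The cone `𝒦` of nonnegative pairs `(m, h)`. -/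
def cone {d : ℕ} (e : Exponents) (Ω ΓD : Set (E d)) : Set (DensitySpace e Ω × FluxSpace e ΓD) :=
  {mh | 0 ≤ mh.1 ∧ 0 ≤ mh.2}

/-- `(m, h) ∈ 𝒦` solves `⟨A_u (m, h), (μ - m, k - h)⟩ ≥ 0` for all `(μ, k) ∈ 𝒦`. -/
def SolvesVI {d : ℕ} {e : Exponents} {Ω ΓD ΓN : Set (E d)} (ε : ℝ)
    (H : E d → E d → ℝ) (g : ℝ → ℝ) (j : FluxSpace e ΓN) (u : ValueSpace e Ω)
    (mh : DensitySpace e Ω × FluxSpace e ΓD) : Prop :=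
  mh ∈ cone e Ω ΓD ∧ ∀ μk ∈ cone e Ω ΓD, 0 ≤ restrictedPairing ε H g j u mh (μk - mh)

end

end MFG

/-! With test direction `v = 0` the operator loses its coupling terms and splits into a part on `Ω`
and a part on `ΓD`. Each has the pointwise form `-f + θ(m)` with `θ` strictly increasing on `[0,
∞)`: `θ = g`, `f = H(x, Du)` inside, and `θ(h) = ε^{γ'} h^{γ'-1}`, `f = u` on the boundary. Such an
inequality over nonnegative functions is a pointwise complementarity problem, solved only by `m =
G(f)`, with `G` the extended inverse of `θ`. So the solution is explicit, and no abstract existence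
theorem for monotone operators is needed.

If `m` solves the inequality, testing with `G(f)` bounds the integral of `(-f + θ(m)) (G(f) - m)`
below by `0`; but this integrand is nonpositive and vanishes only where `m = G(f)`
(`residual_mul_sub_le`). Conversely, complementarity of `G(f)` gives the inequality. `G(f)` is an
admissible test function by the growth conditions (`memLp_extendedInverse`, `memLp_flux`). Both
directions meet in `solvesVI_iff`. -/

namespace MFG

/-! ### Exponents -/

namespace Exponents

theorem holderConjugate_γ (e : Exponents) : e.γ.HolderConjugate e.γ' :=
  Real.HolderConjugate.conjExponent e.one_lt_γ

theorem holderConjugate_β (e : Exponents) : ((e.β + 1) / e.β).HolderConjugate (e.β + 1) := by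
  have h := e.β_pos
  refine Real.HolderConjugate.symm ((Real.holderConjugate_iff_eq_conjExponent (by linarith)).2 ?_)
  rw [add_sub_cancel_right]

theorem γ_div_α (e : Exponents) : e.γ / e.α = (e.β + 1) / e.β := by
  have h := e.one_lt_α
  unfold γ
  exact mul_div_cancel_right₀ _ (by positivity)

theorem one_lt_γ' (e : Exponents) : 1 < e.γ' := e.holderConjugate_γ.symm.lt

theorem γ'_div (e : Exponents) : e.γ' / (e.γ' - 1) = e.γ :=
  e.holderConjugate_γ.symm.conjugate_eq.symm

theorem γ_mul_γ'_sub_one (e : Exponents) : e.γ * (e.γ' - 1) = e.γ' := by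
  have h := e.one_lt_γ'
  rw [← e.γ'_div]
  exact div_mul_cancel₀ _ (by linarith)

theorem γ_sub_one_mul_γ'_sub_one (e : Exponents) : (e.γ - 1) * (e.γ' - 1) = 1 := by
  have := e.γ_mul_γ'_sub_one
  linarith

end Exponents

/-! ### Extended inverses and complementarity -/

theorem IsExtendedInverse.complementarity {θ G : ℝ → ℝ} (hG : IsExtendedInverse θ G) (z : ℝ) :
    0 ≤ -z + θ (G z) ∧ G z * (-z + θ (G z)) = 0 := by
  rcases le_or_gt (θ 0) z with hz | hz
  · simp [hG.2.1 z hz]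
  · rw [hG.2.2 z hz]
    exact ⟨by linarith, by simp⟩

theorem IsExtendedInverse.monotone {θ G : ℝ → ℝ} (hθ : StrictMonoOn θ (Ici 0))
    (hG : IsExtendedInverse θ G) : Monotone G := by
  intro a b hab
  rcases le_or_gt (θ 0) a with ha | ha
  · rw [← hθ.le_iff_le (hG.1 a) (hG.1 b), hG.2.1 a ha, hG.2.1 b (ha.trans hab)]
    exact hab
  · rw [hG.2.2 a ha]
    exact hG.1 b

/-- Inserting `θ (G z)` splits the product into a strict monotonicity term, negative unless `m = G
z`, and two complementarity terms, one zero and the other of favourable sign. -/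
theorem IsExtendedInverse.residual_mul_sub_le {θ G : ℝ → ℝ} (hθ : StrictMonoOn θ (Ici 0))
    (hG : IsExtendedInverse θ G) {z m : ℝ} (hm : 0 ≤ m) :
    (-z + θ m) * (G z - m) ≤ 0 ∧ ((-z + θ m) * (G z - m) = 0 → m = G z) := by
  obtain ⟨h1, h2⟩ := hG.complementarity z
  have h3 : (-z + θ m) * (G z - m) =
      (θ m - θ (G z)) * (G z - m) + G z * (-z + θ (G z)) - m * (-z + θ (G z)) := by ring
  have h4 : 0 ≤ m * (-z + θ (G z)) := mul_nonneg hm h1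
  rcases lt_trichotomy m (G z) with h | h | h
  · have h5 : (θ m - θ (G z)) * (G z - m) < 0 :=
      mul_neg_of_neg_of_pos (sub_neg.2 (hθ hm (hG.1 z) h)) (sub_pos.2 h)
    exact ⟨by linarith, fun h0 => by linarith⟩
  · simp [← h]
  · have h5 : (θ m - θ (G z)) * (G z - m) < 0 :=
      mul_neg_of_pos_of_neg (sub_pos.2 (hθ (hG.1 z) hm h)) (sub_neg.2 h)
    exact ⟨by linarith, fun h0 => by linarith⟩

theorem IsExtendedInverse.ae_eq_of_integral_nonneg {X : Type*} [MeasurableSpace X] {ν : Measure X}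
    {θ G : ℝ → ℝ} (hθ : StrictMonoOn θ (Ici 0)) (hG : IsExtendedInverse θ G) {f m : X → ℝ}
    (hm : 0 ≤ᵐ[ν] m) (hi : Integrable (fun x => (-f x + θ (m x)) * (G (f x) - m x)) ν)
    (h : 0 ≤ ∫ x, (-f x + θ (m x)) * (G (f x) - m x) ∂ν) : m =ᵐ[ν] fun x => G (f x) := by
  have hle : (0 : X → ℝ) ≤ᵐ[ν] fun x => -((-f x + θ (m x)) * (G (f x) - m x)) := by
    filter_upwards [hm] with x hx
    exact neg_nonneg.2 (hG.residual_mul_sub_le hθ hx).1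
  have h0 : ∫ x, -((-f x + θ (m x)) * (G (f x) - m x)) ∂ν = 0 := by
    refine le_antisymm ?_ (integral_nonneg_of_ae hle)
    rw [integral_neg]
    linarith
  filter_upwards [hm, (integral_eq_zero_iff_of_nonneg_ae hle hi.neg).1 h0] with x hx hx0
  exact (hG.residual_mul_sub_le hθ hx).2 (neg_eq_zero.1 hx0)

/-- Complementarity removes the `m` part of the product, leaving a nonnegative residual times `μ ≥
0`. -/
theorem IsExtendedInverse.integral_residual_mul_sub_nonneg {X : Type*} [MeasurableSpace X]
    {ν : Measure X} {θ G : ℝ → ℝ} (hG : IsExtendedInverse θ G) {f m μ : X → ℝ}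
    (hm : m =ᵐ[ν] fun x => G (f x)) (hμ : 0 ≤ᵐ[ν] μ) :
    0 ≤ ∫ x, (-f x + θ (m x)) * (μ x - m x) ∂ν := by
  refine integral_nonneg_of_ae ?_
  filter_upwards [hm, hμ] with x hx hμx
  obtain ⟨h1, h2⟩ := hG.complementarity (f x)
  have h3 : 0 ≤ (-f x + θ (G (f x))) * μ x := mul_nonneg h1 hμx
  simp only [Pi.zero_apply, hx]
  linarith

/-- The boundary flux law `z ↦ ε^{-γ} z₊^{γ-1}` is the extended inverse of
`h ↦ ε^{γ'} h^{γ'-1}`. -/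
theorem isExtendedInverse_flux (e : Exponents) {ε : ℝ} (hε : 0 < ε) :
    IsExtendedInverse (fun h => ε ^ e.γ' * h ^ (e.γ' - 1))
      (fun z => ε ^ (-e.γ) * (max z 0) ^ (e.γ - 1)) := by
  have h1 := e.one_lt_γ
  have h2 := e.one_lt_γ'
  have h0 : ε ^ e.γ' * (0 : ℝ) ^ (e.γ' - 1) = 0 := by
    rw [Real.zero_rpow (by linarith), mul_zero]
  refine ⟨fun z => by positivity, fun z hz => ?_, fun z hz => ?_⟩
  -- The powers of `ε` cancel by `γ (γ' - 1) = γ'`, and `z` reappears by `(γ - 1) (γ' - 1) = 1`.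
  · simp only [h0] at hz ⊢
    rw [max_eq_left hz, Real.mul_rpow (by positivity) (by positivity), ← Real.rpow_mul hε.le,
      ← Real.rpow_mul hz, e.γ_sub_one_mul_γ'_sub_one, neg_mul, e.γ_mul_γ'_sub_one, Real.rpow_one,
      ← mul_assoc, ← Real.rpow_add hε, add_neg_cancel, Real.rpow_zero, one_mul]
  · simp only [h0] at hz ⊢
    rw [max_eq_right hz.le, Real.zero_rpow (by linarith), mul_zero]

theorem strictMonoOn_flux (e : Exponents) {ε : ℝ} (hε : 0 < ε) :
    StrictMonoOn (fun h : ℝ => ε ^ e.γ' * h ^ (e.γ' - 1)) (Ici 0) := by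
  intro a ha b _ hab
  have h2 := e.one_lt_γ'
  exact mul_lt_mul_of_pos_left (Real.rpow_lt_rpow ha hab (by linarith)) (by positivity)

/-! ### Integrability and measurability -/

theorem memLp_norm_rpow {X F : Type*} [MeasurableSpace X] {ν : Measure X} [NormedAddCommGroup F]
    {f : X → F} {p q : ℝ} (hq : 0 < q) (hf : MemLp f (ENNReal.ofReal p) ν) :
    MemLp (fun x => ‖f x‖ ^ q) (ENNReal.ofReal (p / q)) ν := by
  have h := hf.norm_rpow_div (ENNReal.ofReal q)
  rwa [ENNReal.toReal_ofReal hq.le, ← ENNReal.ofReal_div_of_pos hq] at h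

/-- A Carathéodory function composed with a strongly measurable function is measurable. -/
theorem aemeasurable_caratheodory {X F : Type*} [MeasurableSpace X] {ν : Measure X}
    [TopologicalSpace F] {K : X → F → ℝ} (hK : ∀ p, AEMeasurable (fun x => K x p) ν)
    (hc : ∀ᵐ x ∂ν, Continuous (K x)) {f : X → F} (hf : AEStronglyMeasurable f ν) :
    AEMeasurable (fun x => K x (f x)) ν := by
  have key : AEMeasurable (fun x => K x (hf.mk f x)) ν := by
    have hs := hf.stronglyMeasurable_mk
    refine aemeasurable_of_tendsto_metrizable_ae atTop
      (f := fun n x => K x (hs.approx n x)) (fun n => ?_) ?_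
    -- A simple function has finitely many fibres, and on each of them `K x (s x)` is `K x y` with
    -- `y` fixed. Continuity of `K x` then handles the limit.
    · generalize hs.approx n = s
      have hcover : (⋃ y : s.range, s ⁻¹' {(y : F)}) = univ := by
        ext x
        simp
      rw [← Measure.restrict_univ (μ := ν), ← hcover, aemeasurable_iUnion_iff]
      intro y
      refine (hK y).restrict.congr ?_
      filter_upwards [ae_restrict_mem (s.measurableSet_fiber y)] with x hx
      rw [show s x = y from hx]
    · filter_upwards [hc] with x hx
      exact (hx.tendsto _).comp (hs.tendsto_approx x)
  refine key.congr ?_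
  filter_upwards [hf.ae_eq_mk] with x hx
  rw [hx]

/-- Along the segment from `0` to `p`, the slope of a convex function is at most its derivative at
the right endpoint. -/
theorem sub_le_inner_gradient {F : Type*} [NormedAddCommGroup F] [InnerProductSpace ℝ F]
    [CompleteSpace F] {f : F → ℝ} (hf : ConvexOn ℝ univ f) {p : F} (hd : DifferentiableAt ℝ f p) :
    f p - f 0 ≤ inner ℝ (gradient f p) p := by
  have hconv : ConvexOn ℝ univ (fun t : ℝ => f (t • p)) :=
    hf.comp_linearMap (LinearMap.toSpanSingleton ℝ F p)
  have hline : HasDerivAt (fun t : ℝ => t • p) p 1 := by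
    simpa using (hasDerivAt_id (1 : ℝ)).smul_const p
  have hderiv : HasDerivAt (fun t : ℝ => f (t • p)) (fderiv ℝ f p p) 1 := by
    have h : HasFDerivAt f (fderiv ℝ f p) ((1 : ℝ) • p) := by
      rw [one_smul]
      exact hd.hasFDerivAt
    exact h.comp_hasDerivAt (1 : ℝ) hline
  have h := hconv.slope_le_of_hasDerivAt (mem_univ 0) (mem_univ 1) one_pos hderiv
  simpa [slope_def_field, inner_gradient_left] using h

/-! ### Consequences of the structural assumptions -/

section

variable {d : ℕ} {e : Exponents} {Ω ΓD ΓN : Set (E d)} {H : E d → E d → ℝ} {g : ℝ → ℝ}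

theorem StructuralAssumptions.isExtendedInverse (hS : StructuralAssumptions e Ω H g) :
    IsExtendedInverse g (extendedInverse g) :=
  (hS.isExtendedInverse_iff _).2 rfl

/-- Each of the three coercivity alternatives bounds `H` below. Above, convexity gives `H(x,p) ≤
H(x,0) + D_pH(x,p)·p`, and the gradient growth applies. -/
theorem StructuralAssumptions.abs_H_le (hS : StructuralAssumptions e Ω H g) :
    ∃ K : ℝ, ∀ᵐ x ∂(volume.restrict Ω), ∀ p, |H x p| ≤ K * ‖p‖ ^ e.α + K := by
  obtain ⟨C₁, hC₁, h1⟩ := hS.growth_H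
  obtain ⟨C₂, hC₂, h2⟩ := hS.coercive_H
  have hα := e.one_lt_α
  -- The upper bound is `C₁‖p‖^α + C₁‖p‖ + C₁`, and `‖p‖ ≤ 1 + ‖p‖^α` turns it into `2 C₁ (‖p‖^α +
  -- 1)`; `C₂` covers the lower bound.
  refine ⟨2 * C₁ + C₂, ?_⟩
  filter_upwards [h1, h2, hS.c1_H, hS.convex_H] with x hx1 hx2 hc hconv p
  have hp : 0 ≤ ‖p‖ ^ e.α := by positivity
  have hp1 : ‖p‖ ≤ 1 + ‖p‖ ^ e.α := by
    rcases le_or_gt ‖p‖ 1 with h | h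
    · linarith
    · have := Real.rpow_le_rpow_of_exponent_le h.le hα.le
      rw [Real.rpow_one] at this
      linarith
  have hmul : ‖p‖ ^ (e.α - 1) * ‖p‖ = ‖p‖ ^ e.α := by
    rcases (norm_nonneg p).eq_or_lt with h | h
    · rw [← h, mul_zero, Real.zero_rpow (by linarith)]
    · rw [Real.rpow_sub_one h.ne', div_mul_cancel₀ _ h.ne']
  have hlow : -C₂ ≤ H x p := by
    have : 0 ≤ C₂⁻¹ * ‖p‖ ^ e.α := by positivity
    rcases hx2 p with h | h | h
    · linarith
    · exact h.2
    · exact h.2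
  have hup : H x p ≤ 2 * C₁ * ‖p‖ ^ e.α + 2 * C₁ := by
    have a := sub_le_inner_gradient (p := p) hconv ((hc.differentiable one_ne_zero) p)
    have b := (real_inner_le_norm (DpH H x p) p).trans
      (mul_le_mul_of_nonneg_right (hx1.1 p) (norm_nonneg p))
    rw [add_mul, mul_assoc, hmul] at b
    have c := mul_le_mul_of_nonneg_left hp1 (by linarith : 0 ≤ C₁)
    have a' : H x p - H x 0 ≤ inner ℝ (DpH H x p) p := a
    linarith [hx1.2]
  have h3 : 0 ≤ C₂ * ‖p‖ ^ e.α := by positivity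
  have h4 : 0 ≤ C₁ * ‖p‖ ^ e.α := by positivity
  rw [abs_le]
  constructor <;> linarith

theorem StructuralAssumptions.memLp_H (hS : StructuralAssumptions e Ω H g)
    (hΩ : Bornology.IsBounded Ω) (u : ValueSpace e Ω) :
    MemLp (fun x => H x (W1p.grad u x)) (ENNReal.ofReal ((e.β + 1) / e.β))
      (volume.restrict Ω) := by
  have : IsFiniteMeasure (volume.restrict Ω) :=
    isFiniteMeasure_restrict.2 hΩ.measure_lt_top.ne
  obtain ⟨K, hK⟩ := hS.abs_H_le
  have hα := e.one_lt_α
  have hG := memLp_norm_rpow (q := e.α) (by linarith) (Lp.memLp (W1p.grad u))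
  rw [e.γ_div_α] at hG
  refine ((hG.const_mul K).add (memLp_const K)).mono' ?_ ?_
  · refine (aemeasurable_caratheodory hS.measurable_H ?_
      (Lp.aestronglyMeasurable _)).aestronglyMeasurable
    filter_upwards [hS.c1_H] with x hx
    exact hx.continuous
  · filter_upwards [hK] with x hx
    exact hx _

theorem StructuralAssumptions.memLp_g (hS : StructuralAssumptions e Ω H g)
    (hΩ : Bornology.IsBounded Ω) {m : DensitySpace e Ω} (hm : 0 ≤ m) :
    MemLp (fun x => g (m x)) (ENNReal.ofReal ((e.β + 1) / e.β)) (volume.restrict Ω) := by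
  have : IsFiniteMeasure (volume.restrict Ω) :=
    isFiniteMeasure_restrict.2 hΩ.measure_lt_top.ne
  obtain ⟨C, hC, hg⟩ := hS.growth_g
  have hm0 : 0 ≤ᵐ[volume.restrict Ω] m := (Lp.coeFn_nonneg m).2 hm
  refine (((memLp_norm_rpow e.β_pos (Lp.memLp m)).const_mul C).add (memLp_const C)).mono' ?_ ?_
  -- `g` is only continuous on `[0, ∞)`; truncating its argument changes nothing a.e. because `m ≥
  -- 0`.
  · have hcont : Continuous (fun t : ℝ => g (max t 0)) :=
      hS.continuous_g.comp_continuous (by fun_prop) fun t => le_max_right t 0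
    refine (hcont.comp_aestronglyMeasurable (Lp.aestronglyMeasurable m)).congr ?_
    filter_upwards [hm0] with x hx
    rw [max_eq_left (show 0 ≤ m x from hx)]
  · filter_upwards [hm0] with x hx
    obtain ⟨h1, h2⟩ := hg (m x) hx
    have h3 : 0 ≤ C * m x ^ e.β := mul_nonneg (by linarith) (Real.rpow_nonneg hx _)
    have h4 : 0 ≤ C⁻¹ * m x ^ e.β :=
      mul_nonneg (inv_nonneg.2 (by linarith)) (Real.rpow_nonneg hx _)
    simp only [Pi.add_apply, Real.norm_of_nonneg hx]
    rw [Real.norm_eq_abs, abs_le]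
    constructor <;> linarith

theorem StructuralAssumptions.memLp_hjResidual (hS : StructuralAssumptions e Ω H g)
    (hΩ : Bornology.IsBounded Ω) (u : ValueSpace e Ω) {m : DensitySpace e Ω} (hm : 0 ≤ m) :
    MemLp (hjResidual H g m u) (ENNReal.ofReal ((e.β + 1) / e.β)) (volume.restrict Ω) :=
  (hS.memLp_H hΩ u).neg.add (hS.memLp_g hΩ hm)

/-- The lower growth bound on `g` inverts to `g⁻¹(z)^β ≤ C (|z| + C)`. Hence the `β`-th power lies
in `L^{(β+1)/β}` along with `H(x, Du)`, and taking the `β`-th root gives `L^{β+1}`. Measurability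
comes from monotonicity of `g⁻¹`. -/
theorem StructuralAssumptions.memLp_extendedInverse (hS : StructuralAssumptions e Ω H g)
    (hΩ : Bornology.IsBounded Ω) (u : ValueSpace e Ω) :
    MemLp (fun x => extendedInverse g (H x (W1p.grad u x))) (ENNReal.ofReal (e.β + 1))
      (volume.restrict Ω) := by
  have : IsFiniteMeasure (volume.restrict Ω) :=
    isFiniteMeasure_restrict.2 hΩ.measure_lt_top.ne
  obtain ⟨C, hC, hg⟩ := hS.growth_g
  have hG := hS.isExtendedInverse
  have hβ := e.β_pos
  have hH := hS.memLp_H hΩ u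
  have hmeas : AEMeasurable (fun x => extendedInverse g (H x (W1p.grad u x)))
      (volume.restrict Ω) :=
    (hG.monotone hS.strictMono_g).measurable.comp_aemeasurable hH.1.aemeasurable
  have hpow : MemLp (fun x => extendedInverse g (H x (W1p.grad u x)) ^ e.β)
      (ENNReal.ofReal ((e.β + 1) / e.β)) (volume.restrict Ω) := by
    refine ((hH.norm.add (memLp_const C)).const_mul C).mono'
      (hmeas.pow_const _).aestronglyMeasurable (Eventually.of_forall fun x => ?_)
    set z := H x (W1p.grad u x)
    have hz := hG.1 z
    have hn : 0 ≤ C * (‖z‖ + C) := by positivity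
    rw [Real.norm_of_nonneg (Real.rpow_nonneg hz _)]
    rcases le_or_gt (g 0) z with h | h
    · have h1 := (hg _ hz).1
      rw [hG.2.1 z h] at h1
      have h2 : C⁻¹ * extendedInverse g z ^ e.β ≤ ‖z‖ + C := by
        linarith [Real.le_norm_self z]
      rwa [inv_mul_le_iff₀ (by linarith)] at h2
    · rw [hG.2.2 z h, Real.zero_rpow hβ.ne']
      exact hn
  have h := memLp_norm_rpow (q := e.β⁻¹) (by positivity) hpow
  rw [div_inv_eq_mul, div_mul_cancel₀ _ hβ.ne'] at h
  refine (memLp_congr_ae (Eventually.of_forall fun x => ?_)).1 h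
  have hz := hG.1 (H x (W1p.grad u x))
  simp only [Real.norm_of_nonneg (Real.rpow_nonneg hz _)]
  exact Real.rpow_rpow_inv hz hβ.ne'

/-! ### The boundary terms -/

theorem memLp_trace (hΓ : ΓD ⊆ frontier Ω) (u : ValueSpace e Ω) :
    MemLp (trace Ω (ENNReal.ofReal e.γ) u) (ENNReal.ofReal e.γ)
      ((surfaceMeasure d).restrict ΓD) :=
  (Lp.memLp _).mono_measure (Measure.restrict_mono hΓ le_rfl)

theorem memLp_boundaryResidual (hΓ : ΓD ⊆ frontier Ω) (ε : ℝ) (u : ValueSpace e Ω)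
    {h : FluxSpace e ΓD} (hh : 0 ≤ h) :
    MemLp (boundaryResidual ε u h) (ENNReal.ofReal e.γ) ((surfaceMeasure d).restrict ΓD) := by
  have h2 := e.one_lt_γ'
  have hp := memLp_norm_rpow (q := e.γ' - 1) (by linarith) (Lp.memLp h)
  rw [e.γ'_div] at hp
  refine (memLp_congr_ae ?_).1 ((memLp_trace hΓ u).neg.add (hp.const_mul (ε ^ e.γ')))
  filter_upwards [(Lp.coeFn_nonneg h).2 hh] with x hx
  simp only [Pi.add_apply, Pi.neg_apply, boundaryResidual, Real.norm_of_nonneg hx]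

theorem memLp_flux (hΓ : ΓD ⊆ frontier Ω) (ε : ℝ) (u : ValueSpace e Ω) :
    MemLp (fun x => ε ^ (-e.γ) * (max (trace Ω (ENNReal.ofReal e.γ) u x) 0) ^ (e.γ - 1))
      (ENNReal.ofReal e.γ') ((surfaceMeasure d).restrict ΓD) := by
  have h1 := e.one_lt_γ
  have hp := memLp_norm_rpow (q := e.γ - 1) (by linarith) (memLp_trace hΓ u).pos_part
  -- The exponent `γ / (γ - 1)` in `hp` is `γ'` by definition.
  refine MemLp.const_mul ((memLp_congr_ae (Eventually.of_forall fun x => ?_)).1 hp) _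
  simp only [Real.norm_of_nonneg (le_max_right _ (0 : ℝ))]

/-! ### The variational inequality -/

theorem restrictedPairing_eq (ε : ℝ) (j : FluxSpace e ΓN) (u : ValueSpace e Ω)
    (hΓD : ΓD ⊆ frontier Ω) (hΓN : ΓN ⊆ frontier Ω)
    (mh μk : DensitySpace e Ω × FluxSpace e ΓD) :
    restrictedPairing ε H g j u mh μk =
      (∫ x in Ω, hjResidual H g mh.1 u x * μk.1 x) +
        ∫ x in ΓD, boundaryResidual ε u mh.2 x * μk.2 x ∂(surfaceMeasure d) := by
  have htr : ∀ {S : Set (E d)}, S ⊆ frontier Ω → ∀ f : E d → ℝ,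
      ∫ x in S, f x * trace Ω (ENNReal.ofReal e.γ) (0 : ValueSpace e Ω) x
        ∂(surfaceMeasure d) = 0 := by
    intro S hS f
    refine integral_eq_zero_of_ae (ae_mono (Measure.restrict_mono hS le_rfl) ?_)
    rw [map_zero]
    filter_upwards [Lp.coeFn_zero ℝ (ENNReal.ofReal e.γ)
      ((surfaceMeasure d).restrict (frontier Ω))] with x hx
    rw [hx, Pi.zero_apply, mul_zero]
  have hgrad : ∫ x in Ω, mh.1 x *
      inner ℝ (DpH H x (W1p.grad u x)) (W1p.grad (0 : ValueSpace e Ω) x) = 0 := by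
    refine integral_eq_zero_of_ae ?_
    have h0 : W1p.grad (0 : ValueSpace e Ω) = 0 := rfl
    rw [h0]
    filter_upwards [Lp.coeFn_zero (E d) (ENNReal.ofReal e.γ) (volume.restrict Ω)] with x hx
    rw [hx, Pi.zero_apply, inner_zero_right, mul_zero, Pi.zero_apply]
  rw [restrictedPairing, pairing, htr hΓD, htr hΓN, hgrad]
  ring

theorem restrictedPairing_sub (ε : ℝ) (j : FluxSpace e ΓN) (u : ValueSpace e Ω)
    (hΓD : ΓD ⊆ frontier Ω) (hΓN : ΓN ⊆ frontier Ω)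
    (mh μk : DensitySpace e Ω × FluxSpace e ΓD) :
    restrictedPairing ε H g j u mh (μk - mh) =
      (∫ x in Ω, (-H x (W1p.grad u x) + g (mh.1 x)) * (μk.1 x - mh.1 x)) +
        ∫ x in ΓD, (-trace Ω (ENNReal.ofReal e.γ) u x + ε ^ e.γ' * mh.2 x ^ (e.γ' - 1)) *
          (μk.2 x - mh.2 x) ∂(surfaceMeasure d) := by
  rw [restrictedPairing_eq ε j u hΓD hΓN]
  congr 1
  · refine integral_congr_ae ?_
    filter_upwards [Lp.coeFn_sub μk.1 mh.1] with x hx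
    rw [Prod.fst_sub, hx]
    rfl
  · refine integral_congr_ae ?_
    filter_upwards [Lp.coeFn_sub μk.2 mh.2] with x hx
    rw [Prod.snd_sub, hx]
    rfl

/-- The cone is a product, so either component can be varied with the other frozen; the frozen
component contributes zero and the inequality decouples. -/
theorem solvesVI_iff (hS : StructuralAssumptions e Ω H g) (hΩ : Bornology.IsBounded Ω)
    (hΓD : ΓD ⊆ frontier Ω) (hΓN : ΓN ⊆ frontier Ω) {ε : ℝ} (hε : 0 < ε) (j : FluxSpace e ΓN)
    (u : ValueSpace e Ω) (mh : DensitySpace e Ω × FluxSpace e ΓD) :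
    SolvesVI ε H g j u mh ↔
      (mh.1 =ᵐ[volume.restrict Ω] fun x => extendedInverse g (H x (W1p.grad u x))) ∧
      (mh.2 =ᵐ[(surfaceMeasure d).restrict ΓD] fun x =>
        ε ^ (-e.γ) * (max (trace Ω (ENNReal.ofReal e.γ) u x) 0) ^ (e.γ - 1)) := by
  have hG := hS.isExtendedInverse
  have hF := isExtendedInverse_flux e hε
  constructor
  · rintro ⟨⟨hm, hh⟩, hVI⟩
    have hmG := hS.memLp_extendedInverse hΩ u
    have hhF := memLp_flux hΓD ε u
    have hm0 := (Lp.coeFn_nonneg mh.1).2 hm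
    have hh0 := (Lp.coeFn_nonneg mh.2).2 hh
    have hconjβ := e.holderConjugate_β.ennrealOfReal
    have hconjγ := e.holderConjugate_γ.ennrealOfReal
    constructor
    -- Integrability of the product is Hölder's inequality for the exponents `(β+1)/β` and `β+1`.
    · refine hG.ae_eq_of_integral_nonneg hS.strictMono_g hm0
        ((hS.memLp_hjResidual hΩ u hm).integrable_mul (hmG.sub (Lp.memLp mh.1))) ?_
      have hpos : 0 ≤ hmG.toLp := by
        rw [← Lp.coeFn_nonneg]
        filter_upwards [hmG.coeFn_toLp] with x hx
        rw [hx]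
        exact hG.1 _
      have h := hVI (hmG.toLp, mh.2) ⟨hpos, hh⟩
      rw [restrictedPairing_sub ε j u hΓD hΓN] at h
      simp only [sub_self, mul_zero, integral_zero, add_zero] at h
      refine h.trans_eq (integral_congr_ae ?_)
      filter_upwards [hmG.coeFn_toLp] with x hx
      rw [hx]
    · refine hF.ae_eq_of_integral_nonneg (strictMonoOn_flux e hε) hh0
        ((memLp_boundaryResidual hΓD ε u hh).integrable_mul (hhF.sub (Lp.memLp mh.2))) ?_
      have hpos : 0 ≤ hhF.toLp := by
        rw [← Lp.coeFn_nonneg]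
        filter_upwards [hhF.coeFn_toLp] with x hx
        rw [hx]
        exact hF.1 _
      have h := hVI (mh.1, hhF.toLp) ⟨hm, hpos⟩
      rw [restrictedPairing_sub ε j u hΓD hΓN] at h
      simp only [sub_self, mul_zero, integral_zero, zero_add] at h
      refine h.trans_eq (integral_congr_ae ?_)
      filter_upwards [hhF.coeFn_toLp] with x hx
      rw [hx]
  · rintro ⟨hm, hh⟩
    refine ⟨⟨?_, ?_⟩, fun μk hμk => ?_⟩
    · rw [← Lp.coeFn_nonneg]
      filter_upwards [hm] with x hx
      rw [hx]
      exact hG.1 _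
    · rw [← Lp.coeFn_nonneg]
      filter_upwards [hh] with x hx
      rw [hx]
      exact hF.1 _
    · rw [restrictedPairing_sub ε j u hΓD hΓN]
      exact add_nonneg
        (hG.integral_residual_mul_sub_nonneg hm ((Lp.coeFn_nonneg μk.1).2 hμk.1))
        (hF.integral_residual_mul_sub_nonneg hh ((Lp.coeFn_nonneg μk.2).2 hμk.2))

end

end MFG

theorem mainTheorem3 {d : ℕ} (e : MFG.Exponents) (Ω ΓD ΓN : Set (MFG.E d))
    (hdom : MFG.IsMixedDomain Ω ΓD ΓN)
    (H : MFG.E d → MFG.E d → ℝ) (g : ℝ → ℝ)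
    (hS : MFG.StructuralAssumptions e Ω H g)
    (j : MFG.FluxSpace e ΓN) (hj_nonneg : 0 ≤ j) (hj_ne : j ≠ 0)
    (ε : ℝ) (hε : 0 < ε) (u : MFG.ValueSpace e Ω) :
    -- `A_u` maps `𝒦` into `L^{(β+1)/β}(Ω) × L^γ(Γ_D)`
    (∀ mh ∈ MFG.cone e Ω ΓD,
      MemLp (MFG.hjResidual H g mh.1 u) (ENNReal.ofReal ((e.β + 1) / e.β)) (volume.restrict Ω) ∧
      MemLp (MFG.boundaryResidual ε u mh.2) (ENNReal.ofReal e.γ)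
        ((MFG.surfaceMeasure d).restrict ΓD)) ∧
    -- existence and uniqueness
    (∃! mh : MFG.DensitySpace e Ω × MFG.FluxSpace e ΓD, MFG.SolvesVI ε H g j u mh) ∧
    -- characterization of the solution
    (∀ mh : MFG.DensitySpace e Ω × MFG.FluxSpace e ΓD, MFG.SolvesVI ε H g j u mh →
      (∀ᵐ x ∂(volume.restrict Ω),
        0 ≤ -H x (MFG.W1p.grad u x) + g (mh.1 x) ∧
        mh.1 x * (-H x (MFG.W1p.grad u x) + g (mh.1 x)) = 0 ∧
        mh.1 x = MFG.extendedInverse g (H x (MFG.W1p.grad u x))) ∧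
      (∀ᵐ x ∂((MFG.surfaceMeasure d).restrict ΓD),
        0 ≤ -MFG.trace Ω (ENNReal.ofReal e.γ) u x + ε ^ e.γ' * mh.2 x ^ (e.γ' - 1) ∧
        mh.2 x * (-MFG.trace Ω (ENNReal.ofReal e.γ) u x + ε ^ e.γ' * mh.2 x ^ (e.γ' - 1)) = 0 ∧
        mh.2 x = ε ^ (-e.γ) * (max (MFG.trace Ω (ENNReal.ofReal e.γ) u x) 0) ^ (e.γ - 1))) := by
  have hΓD : ΓD ⊆ frontier Ω := by
    obtain ⟨U, -, rfl⟩ := hdom.relOpen_D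
    exact inter_subset_right
  have hΓN : ΓN ⊆ frontier Ω := by
    obtain ⟨U, -, rfl⟩ := hdom.relOpen_N
    exact inter_subset_right
  have hΩ := hdom.isBounded
  have hiff := MFG.solvesVI_iff hS hΩ hΓD hΓN hε j u
  have hmG := hS.memLp_extendedInverse hΩ u
  have hhF := MFG.memLp_flux hΓD ε u
  refine ⟨fun mh hmh => ⟨hS.memLp_hjResidual hΩ u hmh.1,
    MFG.memLp_boundaryResidual hΓD ε u hmh.2⟩,
    -- The explicit formulas define the witness. They fix both components a.e., hence as `Lp`
    -- classes, which gives uniqueness.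
    ⟨(hmG.toLp, hhF.toLp), (hiff _).2 ⟨hmG.coeFn_toLp, hhF.coeFn_toLp⟩, fun mh hmh => ?_⟩,
    fun mh hmh => ⟨?_, ?_⟩⟩
  · obtain ⟨h1, h2⟩ := (hiff mh).1 hmh
    exact Prod.ext (Lp.ext (h1.trans hmG.coeFn_toLp.symm))
      (Lp.ext (h2.trans hhF.coeFn_toLp.symm))
  · filter_upwards [((hiff mh).1 hmh).1] with x hx
    obtain ⟨h1, h2⟩ := hS.isExtendedInverse.complementarity (H x (MFG.W1p.grad u x))
    rw [hx]
    exact ⟨h1, h2, rfl⟩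
  · filter_upwards [((hiff mh).1 hmh).2] with x hx
    obtain ⟨h1, h2⟩ := (MFG.isExtendedInverse_flux e hε).complementarity
      (MFG.trace Ω (ENNReal.ofReal e.γ) u x)
    rw [hx]
    exact ⟨h1, h2, rfl⟩
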